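/- Let $d\ge 1$ and $0<\alpha<2$. Let $X=(X_t)_{t\ge 0}$ be a symmetric $\alpha$-stable process in $\mathbb{R}^d$, i.e. a Lévy process started at $0$ with $\mathbb{E}\,e^{iu\cdot X_t}=e^{-t|u|^{\alpha}}$ for all $t\ge 0$ and $u\in\mathbb{R}^d$. Then $X$ has a continuous transition density $p_t(x,y)$: for all $t>0$ and $x\in\mathbb{R}^d$ the function $y\mapsto p_t(x,y)$ is nonnegative and continuous and is the density of $x+X_t$ with respect to Lebesgue measure. For every $t>0$ the function $x\mapsto p_t(0,x)$ is $C^\infty$, and there is a constant $c>0$ depending only on $d$ and $\alpha$ such that for $k=0,1,2$, for every partial derivative $\partial^k$ of order $k$ with respect to $x$ (with $\partial^0p_t=p_t$), and all $x\in\mathbb{R}^d$, (a) $\displaystyle |\partial^k p_1(0,x)|\le c\,\bigl(1\wedge |x|^{-(d+\alpha+k)}\bigr)$; (b) $\displaystyle |\partial^k p_t(0,x)|\le c\,t^{-(d+k)/\alpha}\bigl(1\wedge (t^{1/\alpha}|x|^{-1})\bigr)^{d+\alpha+k}$ for all $t>0$. Here $a\wedge b=\min\{a,b\}$, $|x|$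 is the Euclidean norm, and negative powers of $|x|$ are read as $+\infty$ at $x=0$. -/

import Mathlib

open MeasureTheory ProbabilityTheory Filter Topology
open scoped NNReal

namespace SymStable

/-- Right continuous with left limits at every time (at time `0` the left limit is no condition,
since `𝓝[<] (0 : ℝ≥0) = ⊥`). -/
def IsCadlagPath {E : Type*} [TopologicalSpace E] (w : ℝ≥0 → E) : Prop :=
  ∀ t : ℝ≥0, ContinuousWithinAt w (Set.Ici t) t ∧ ∃ l : E, Tendsto w (𝓝[<] t) (𝓝 l)

/-- `X` is a symmetric stable process of index `α` in `ℝᵈ`: a Lévy process (started at `0`) with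
`𝔼 exp(i u · X_t) = exp(-t |u|^α)`. -/
structure IsSymmetricStable (d : ℕ) (α : ℝ) {Ω : Type*} [MeasurableSpace Ω] (P : Measure Ω)
    (X : ℝ≥0 → Ω → EuclideanSpace ℝ (Fin d)) : Prop where
  measurable : ∀ t, Measurable (X t)
  start_zero : ∀ᵐ ω ∂P, X 0 ω = 0
  indep_increments : HasIndepIncrements X P
  stationary_increments : ∀ s t : ℝ≥0, P.map (X (s + t) - X s) = P.map (X t)
  cadlag : ∀ᵐ ω ∂P, IsCadlagPath (fun t => X t ω)
  charFun_eq : ∀ (t : ℝ≥0) (u : EuclideanSpace ℝ (Fin d)),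
    charFun (P.map (X t)) u = ((Real.exp (-((t : ℝ) * ‖u‖ ^ α)) : ℝ) : ℂ)

/-- `p t x y` is the (continuous) transition density of the Lévy process `X`: the process started
at `x` is `x + X`, and its law at a time `t > 0` is `p t x y dy`. Continuity in `y` singles out one
version of the density. -/
structure IsTransitionDensity {d : ℕ} {Ω : Type*} [MeasurableSpace Ω] (P : Measure Ω)
    (X : ℝ≥0 → Ω → EuclideanSpace ℝ (Fin d))
    (p : ℝ≥0 → EuclideanSpace ℝ (Fin d) → EuclideanSpace ℝ (Fin d) → ℝ) : Prop where
  nonneg : ∀ t, 0 < t → ∀ x y, 0 ≤ p t x y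
  continuous : ∀ t, 0 < t → ∀ x, Continuous (p t x)
  law_eq : ∀ t, 0 < t → ∀ x,
    P.map (fun ω => x + X t ω) = volume.withDensity (fun y => ENNReal.ofReal (p t x y))

/-- The `k`-th order partial derivative `∂_{v 0} ⋯ ∂_{v (k-1)} f (x)` of a function that is `k`
times continuously differentiable; for `k = 0` it is `f x`. -/
noncomputable def partialDeriv {d k : ℕ} (v : Fin k → Fin d) (f : EuclideanSpace ℝ (Fin d) → ℝ)
    (x : EuclideanSpace ℝ (Fin d)) : ℝ :=
  iteratedFDeriv ℝ k f x (fun j => EuclideanSpace.single (v j) (1 : ℝ))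

/-- `1 ∧ r ^ (-s)` for `r ≥ 0`, `s > 0`, where `0 ^ (-s) = ∞`. -/
noncomputable def oneMinPowNeg (r s : ℝ) : ℝ := if r = 0 then 1 else min 1 (r ^ (-s))

/-- `1 ∧ (a r⁻¹)` for `r ≥ 0`, `a > 0`, where `a 0⁻¹ = ∞`. -/
noncomputable def oneMinMulInv (a r : ℝ) : ℝ := if r = 0 then 1 else min 1 (a * r⁻¹)

end SymStable

/-! The law of `X_t` has characteristic function `exp (-t |u| ^ α)`, so its density is, up to scaling,
the Fourier transform of `stableExp β u = exp (-(π |u|²) ^ β)` with `β = α / 2 ∈ (0, 1)`. The factors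
`u_j` produced by differentiation do not affect integrability, so the density is smooth; the
difficulty is the decay `|x| ^ (-(d + α + k))` of its derivatives of order `k`.

The decay comes from subordination: the stable density is a mixture of Gaussians. Instead of
constructing the stable subordinator, it is approximated by normalized sums of `n` independent Sibuya
variables, whose generating function `1 - (1 - z) ^ β` has nonnegative Taylor coefficients by the
binomial series. With `φ_n = sibuyaLaplace β n` their Laplace transform,
`φ_n y = ∑ b_m exp (-m h y)` with `b_m ≥ 0` and `∑ b_m ≤ 1` (`exists_hasSum_sibuyaLaplace`), while
`φ_n y → exp (-y ^ β)` and `φ_n y ≤ exp (-y ^ β / 2)` (`tendsto_sibuyaLaplace`, `sibuyaLaplace_le`).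

A `k`-th derivative of the Gaussian density of width `σ` is at most
`C |x| ^ (-(d + k)) (1 - exp (-σ² / |x|²))`, simply because the Gaussian is a Schwartz function
(`exists_norm_fourierMonomial_gauss_smul_le`). The point of this form of the bound is that it can be
summed exactly: averaging over `σ² = m h` with the weights `b_m` gives
`C |x| ^ (-(d + k)) (1 - φ_n (1 / |x|²))`. Dominated convergence on the Fourier side turns this
into `C |x| ^ (-(d + k)) (1 - exp (-|x| ^ (-2β))) ≤ C |x| ^ (-(d + k + α))`
(`norm_fourierMonomial_stableExp_le_of_ne_zero`). The same limit shows that the Fourier transform is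
nonnegative (`fourier_stableExp_nonneg`). The decay also makes it integrable, so Fourier inversion
identifies it as the density (`charFun_withDensity_stableDensity`); a continuous density is unique,
and the estimates for general `t` follow by scaling. -/

namespace SymStable

open scoped FourierTransform ContDiff

/-! ### Sums of Sibuya variables -/

/-- Minus the `m`-th coefficient of `(1 - z) ^ β`, apart from the constant term, where it is `0`.
For `0 < β < 1` these are the point masses of the Sibuya distribution of index `β`. -/
noncomputable def sibuyaWeight (β : ℝ) (m : ℕ) : ℝ :=
  if m = 0 then 0 else (-1) ^ (m + 1) * Ring.choose β m

theorem choose_succ_mul (β : ℝ) (m : ℕ) :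
    ((m : ℝ) + 1) * Ring.choose β (m + 1) = (β - m) * Ring.choose β m := by
  have h1 := Ring.descPochhammer_eq_factorial_smul_choose β (m + 1)
  have h2 := Ring.descPochhammer_eq_factorial_smul_choose β m
  rw [descPochhammer_succ_right, Polynomial.smeval_mul, h2] at h1
  simp only [Polynomial.smeval_sub, Polynomial.smeval_X, pow_one, Polynomial.smeval_natCast,
    pow_zero, nsmul_eq_mul, Nat.factorial_succ, Nat.cast_mul, Nat.cast_add, Nat.cast_one,
    mul_one] at h1
  have h3 : (m.factorial : ℝ) ≠ 0 := by positivity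
  apply mul_left_cancel₀ h3
  linear_combination -h1

theorem sibuyaWeight_nonneg {β : ℝ} (h0 : 0 < β) (h1 : β < 1) (m : ℕ) : 0 ≤ sibuyaWeight β m := by
  unfold sibuyaWeight
  split_ifs with h
  · rfl
  obtain ⟨j, rfl⟩ := Nat.exists_eq_succ_of_ne_zero h
  clear h
  induction j with
  | zero => simpa using h0.le
  | succ j ih =>
    have := choose_succ_mul β (j + 1)
    push_cast at this
    have h2 : (-1 : ℝ) ^ (j + 1 + 1 + 1) * Ring.choose β (j + 1 + 1)
        = (j + 1 - β) / (j + 2) * ((-1) ^ (j + 1 + 1) * Ring.choose β (j + 1)) := by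
      field_simp
      rw [pow_succ]
      linear_combination (-1) * (-1 : ℝ) ^ (j + 1 + 1) * this
    simp only [Nat.succ_eq_add_one]
    rw [h2]
    have : (0 : ℝ) ≤ j := Nat.cast_nonneg _
    exact mul_nonneg (div_nonneg (by linarith) (by linarith)) ih

theorem hasSum_sibuyaWeight (β : ℝ) {z : ℝ} (hz0 : 0 ≤ z) (hz1 : z < 1) :
    HasSum (fun m => sibuyaWeight β m * z ^ m) (1 - (1 - z) ^ β) := by
  have h := (Real.one_add_rpow_hasFPowerSeriesOnBall_zero (a := β)).hasSum (y := -z) (by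
    simp only [Metric.mem_eball, edist_zero_right, enorm_neg]
    rw [Real.enorm_of_nonneg hz0, ENNReal.ofReal_lt_one]
    exact hz1)
  have h' := (hasSum_ite_eq 0 (1 : ℝ)).sub h
  have e : ∀ m, sibuyaWeight β m * z ^ m
      = (if m = 0 then 1 else 0) - binomialSeries ℝ β m fun _ => -z := by
    intro m
    by_cases hm : m = 0
    · subst hm
      rw [binomialSeries_apply]
      simp [sibuyaWeight]
    · simp only [sibuyaWeight, hm, if_false, zero_sub]
      rw [binomialSeries_apply]
      simp only [List.ofFn_const, List.prod_replicate, smul_eq_mul]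
      rw [neg_pow z]
      ring
  rw [funext e, show 1 - (1 - z) ^ β = 1 - (1 + (0 + -z)) ^ β by ring_nf]
  exact h'

/-- The powers of the Sibuya generating function are power series with nonnegative coefficients. -/
theorem exists_hasSum_sibuya_pow {β : ℝ} (h0 : 0 < β) (h1 : β < 1) (n : ℕ) :
    ∃ b : ℕ → ℝ, (∀ m, 0 ≤ b m) ∧
      ∀ z : ℝ, 0 ≤ z → z < 1 → HasSum (fun m => b m * z ^ m) ((1 - (1 - z) ^ β) ^ n) := by
  induction n with
  | zero =>
    refine ⟨fun m => if m = 0 then 1 else 0, fun m => by positivity, fun z _ _ => ?_⟩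
    rw [pow_zero]
    convert hasSum_ite_eq 0 (1 : ℝ) using 2 with m
    split_ifs with h <;> simp [h]
  | succ n ih =>
    obtain ⟨b, hb, hs⟩ := ih
    refine ⟨fun m => ∑ p ∈ Finset.HasAntidiagonal.antidiagonal m, b p.1 * sibuyaWeight β p.2,
      fun m => Finset.sum_nonneg fun p _ => mul_nonneg (hb _) (sibuyaWeight_nonneg h0 h1 _),
      fun z hz0 hz1 => ?_⟩
    have hf := hs z hz0 hz1
    have hg := hasSum_sibuyaWeight β hz0 hz1
    have hf' : Summable fun m => ‖b m * z ^ m‖ := by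
      simpa only [Real.norm_eq_abs] using hf.summable.abs
    have hg' : Summable fun m => ‖sibuyaWeight β m * z ^ m‖ := by
      simpa only [Real.norm_eq_abs] using hg.summable.abs
    have e : (fun m =>
          (∑ p ∈ Finset.HasAntidiagonal.antidiagonal m, b p.1 * sibuyaWeight β p.2) * z ^ m)
        = fun m => ∑ p ∈ Finset.HasAntidiagonal.antidiagonal m,
            (b p.1 * z ^ p.1) * (sibuyaWeight β p.2 * z ^ p.2) := by
      funext m
      rw [Finset.sum_mul]
      refine Finset.sum_congr rfl fun p hp => ?_
      rw [← Finset.HasAntidiagonal.mem_antidiagonal.1 hp, pow_add]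
      ring
    rw [e, pow_succ, ← hf.tsum_eq, ← hg.tsum_eq,
      tsum_mul_tsum_eq_tsum_sum_antidiagonal_of_summable_norm hf' hg']
    exact (summable_norm_sum_mul_antidiagonal_of_summable_norm hf' hg').of_norm.hasSum

/-- A power series with nonnegative coefficients that is at most `1` on `[0, 1)` has
coefficients of sum at most `1`. -/
theorem summable_and_tsum_le_one_of_hasSum {b : ℕ → ℝ} {g : ℝ → ℝ} (hb : ∀ m, 0 ≤ b m)
    (hs : ∀ z : ℝ, 0 ≤ z → z < 1 → HasSum (fun m => b m * z ^ m) (g z))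
    (hg : ∀ z : ℝ, 0 ≤ z → z < 1 → g z ≤ 1) : Summable b ∧ ∑' m, b m ≤ 1 := by
  have key : ∀ n, ∑ m ∈ Finset.range n, b m ≤ 1 := by
    intro n
    have hc : Tendsto (fun z : ℝ => ∑ m ∈ Finset.range n, b m * z ^ m) (𝓝[<] 1)
        (𝓝 (∑ m ∈ Finset.range n, b m * 1 ^ m)) :=
      (Continuous.tendsto (by fun_prop) 1).mono_left nhdsWithin_le_nhds
    simp only [one_pow, mul_one] at hc
    refine le_of_tendsto hc ?_
    filter_upwards [Ioo_mem_nhdsLT (zero_lt_one (α := ℝ))] with z hz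
    exact (sum_le_hasSum _ (fun m _ => mul_nonneg (hb m) (pow_nonneg hz.1.le m))
      (hs z hz.1.le hz.2)).trans (hg z hz.1.le hz.2)
  exact ⟨summable_of_sum_range_le hb key, Real.tsum_le_of_sum_range_le hb key⟩

/-- `sibuyaLaplace β n y = (1 - (1 - exp (-y / n ^ (1 / β))) ^ β) ^ n`, the Laplace transform at `y`
of the sum of `n` independent Sibuya variables divided by `n ^ (1 / β)`. -/
noncomputable def sibuyaLaplace (β : ℝ) (n : ℕ) (y : ℝ) : ℝ :=
  (1 - (1 - Real.exp (-((n : ℝ) ^ (-(1 / β)) * y))) ^ β) ^ n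

theorem one_sub_one_sub_exp_rpow_le {β : ℝ} (h0 : 0 < β) (h1 : β < 1) {y : ℝ} (hy : 0 ≤ y) :
    1 - (1 - Real.exp (-y)) ^ β ≤ Real.exp (-(y ^ β / 2)) := by
  -- for `y ≤ 1` use `1 - exp (-y) ≥ y / 2`; for `y ≥ 1` the left side is at most `exp (-y)`
  rcases le_total y 1 with hy1 | hy1
  · have h2 : y / 2 ≤ 1 - Real.exp (-y) := by
      have h3 : Real.exp (-y) * (1 + y) ≤ 1 := by
        calc Real.exp (-y) * (1 + y) ≤ Real.exp (-y) * Real.exp y := by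
              gcongr
              linarith [Real.add_one_le_exp y]
          _ = 1 := by rw [← Real.exp_add]; simp
      nlinarith [Real.exp_pos (-y), Real.exp_le_one_iff.2 (neg_nonpos.2 hy)]
    have h3 : y ^ β / 2 ≤ (1 - Real.exp (-y)) ^ β := by
      calc y ^ β / 2 ≤ y ^ β / 2 ^ β := by
            gcongr
            calc (2 : ℝ) ^ β ≤ 2 ^ (1 : ℝ) :=
                  Real.rpow_le_rpow_of_exponent_le (by norm_num) h1.le
              _ = 2 := Real.rpow_one 2
        _ = (y / 2) ^ β := (Real.div_rpow hy (by norm_num) β).symm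
        _ ≤ _ := Real.rpow_le_rpow (by positivity) h2 h0.le
    have := Real.add_one_le_exp (-(y ^ β / 2))
    linarith
  · have h4 : Real.exp (-y) ≤ 1 := Real.exp_le_one_iff.2 (by linarith)
    have h2 : 1 - Real.exp (-y) ≤ (1 - Real.exp (-y)) ^ β := by
      apply Real.self_le_rpow_of_le_one (by linarith) _ h1.le
      linarith [Real.exp_pos (-y)]
    have h3 : y ^ β ≤ y := Real.rpow_le_self_of_one_le hy1 h1.le
    have h5 : Real.exp (-y) ≤ Real.exp (-(y ^ β / 2)) := Real.exp_le_exp.2 (by linarith)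
    linarith

theorem one_sub_one_sub_exp_rpow_nonneg {β : ℝ} (h0 : 0 < β) {y : ℝ} (hy : 0 ≤ y) :
    0 ≤ 1 - (1 - Real.exp (-y)) ^ β := by
  have h4 : Real.exp (-y) ≤ 1 := Real.exp_le_one_iff.2 (by linarith)
  have := Real.rpow_le_one (x := 1 - Real.exp (-y)) (by linarith)
    (by linarith [Real.exp_pos (-y)]) h0.le
  linarith

theorem sibuyaLaplace_nonneg {β : ℝ} (h0 : 0 < β) (n : ℕ) {y : ℝ} (hy : 0 ≤ y) :
    0 ≤ sibuyaLaplace β n y :=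
  pow_nonneg (one_sub_one_sub_exp_rpow_nonneg h0 (by positivity)) n

theorem natCast_rpow_mul_rpow {β : ℝ} (h0 : 0 < β) {n : ℕ} (hn : n ≠ 0) {y : ℝ} (hy : 0 ≤ y) :
    (n : ℝ) * ((n : ℝ) ^ (-(1 / β)) * y) ^ β = y ^ β := by
  have hn' : (0 : ℝ) < n := by positivity
  rw [Real.mul_rpow (by positivity) hy, ← Real.rpow_mul hn'.le,
    show -(1 / β) * β = -1 by field_simp, Real.rpow_neg_one]
  field_simp

/-- The stable exponential with half the exponent dominates all the approximations. -/
theorem sibuyaLaplace_le {β : ℝ} (h0 : 0 < β) (h1 : β < 1) {n : ℕ} (hn : n ≠ 0) {y : ℝ}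
    (hy : 0 ≤ y) : sibuyaLaplace β n y ≤ Real.exp (-(y ^ β / 2)) := by
  have hy' : 0 ≤ (n : ℝ) ^ (-(1 / β)) * y := by positivity
  refine (pow_le_pow_left₀ (one_sub_one_sub_exp_rpow_nonneg h0 hy')
    (one_sub_one_sub_exp_rpow_le h0 h1 hy') n).trans_eq ?_
  rw [← Real.exp_nat_mul, ← natCast_rpow_mul_rpow h0 hn hy]
  ring_nf

theorem tendsto_sibuyaLaplace {β : ℝ} (h0 : 0 < β) {y : ℝ} (hy : 0 ≤ y) :
    Tendsto (fun n => sibuyaLaplace β n y) atTop (𝓝 (Real.exp (-y ^ β))) := by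
  have hs : Tendsto (fun n : ℕ => (n : ℝ) ^ (-(1 / β))) atTop (𝓝 0) :=
    (tendsto_rpow_neg_atTop (by positivity)).comp tendsto_natCast_atTop_atTop
  -- `n (1 - exp (-s y)) ^ β = ((1 - exp (-s y)) / s) ^ β` for `s = n ^ (-1 / β)`
  have hslope : Tendsto (fun s : ℝ => (1 - Real.exp (-(s * y))) / s) (𝓝[>] 0) (𝓝 y) := by
    have hd : HasDerivAt (fun s : ℝ => 1 - Real.exp (-(s * y))) y 0 := by
      have := (((hasDerivAt_id (0 : ℝ)).mul_const y).neg.exp).const_sub 1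
      simpa using this
    have := hd.tendsto_slope_zero_right
    refine this.congr fun s => ?_
    simp [div_eq_inv_mul]
  have hs' : Tendsto (fun n : ℕ => (n : ℝ) ^ (-(1 / β))) atTop (𝓝[>] 0) := by
    refine tendsto_nhdsWithin_iff.2 ⟨hs, ?_⟩
    filter_upwards [eventually_gt_atTop 0] with n hn
    exact Real.rpow_pos_of_pos (Nat.cast_pos.2 hn) _
  have hlim := ((hslope.comp hs').rpow_const (p := β) (Or.inr h0.le)).neg
  have : Tendsto (fun n : ℕ => (n : ℝ) * -(1 - Real.exp (-((n : ℝ) ^ (-(1 / β)) * y))) ^ β) atTop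
      (𝓝 (-y ^ β)) := by
    refine hlim.congr' ?_
    filter_upwards [eventually_gt_atTop 0] with n hn
    have hn' : (0 : ℝ) < n := Nat.cast_pos.2 hn
    have hpos : 0 < (n : ℝ) ^ (-(1 / β)) := Real.rpow_pos_of_pos hn' _
    have h4 : Real.exp (-((n : ℝ) ^ (-(1 / β)) * y)) ≤ 1 :=
      Real.exp_le_one_iff.2 (by have := mul_nonneg hpos.le hy; linarith)
    simp only [Function.comp_apply]
    rw [Real.div_rpow (by linarith) hpos.le, ← Real.rpow_mul hn'.le,
      show -(1 / β) * β = -1 by field_simp, Real.rpow_neg_one]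
    field_simp
  refine (Real.tendsto_one_add_pow_exp_of_tendsto this).congr fun n => ?_
  simp [sibuyaLaplace, sub_eq_add_neg]

/-- `sibuyaLaplace β n` is a mixture of exponentials `exp (-(m h y))` with positive rates `m h`
and weights of total mass at most `1`. -/
theorem exists_hasSum_sibuyaLaplace {β : ℝ} (h0 : 0 < β) (h1 : β < 1) {n : ℕ} (hn : n ≠ 0) :
    ∃ b : ℕ → ℝ, (∀ m, 0 ≤ b m) ∧ b 0 = 0 ∧ Summable b ∧ ∑' m, b m ≤ 1 ∧
      ∀ y : ℝ, 0 < y →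
        HasSum (fun m : ℕ => b m * Real.exp (-((m : ℝ) * (n : ℝ) ^ (-(1 / β)) * y)))
          (sibuyaLaplace β n y) := by
  obtain ⟨b, hb, hs⟩ := exists_hasSum_sibuya_pow h0 h1 n
  obtain ⟨hsum, hle⟩ := summable_and_tsum_le_one_of_hasSum hb hs (fun z hz0 hz1 => by
    have h2 : 0 ≤ (1 - z) ^ β := Real.rpow_nonneg (by linarith) _
    have h3 : (1 - z) ^ β ≤ 1 := Real.rpow_le_one (by linarith) (by linarith) h0.le
    exact pow_le_one₀ (by linarith) (by linarith))
  refine ⟨b, hb, ?_, hsum, hle, fun y hy => ?_⟩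
  · have h2 := hs 0 le_rfl zero_lt_one
    rw [sub_zero, Real.one_rpow, sub_self, zero_pow hn] at h2
    have h3 : HasSum (fun m : ℕ => b m * (0 : ℝ) ^ m) (b 0 * 0 ^ 0) :=
      hasSum_single 0 fun m hm => by simp [hm]
    simpa using h3.unique h2
  · have hn' : (0 : ℝ) < n := by positivity
    have hy' : 0 < (n : ℝ) ^ (-(1 / β)) * y := mul_pos (Real.rpow_pos_of_pos hn' _) hy
    have := hs (Real.exp (-((n : ℝ) ^ (-(1 / β)) * y))) (Real.exp_pos _).le
      (Real.exp_lt_one_iff.2 (by linarith))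
    rw [sibuyaLaplace]
    convert this using 3 with m
    rw [← Real.exp_nat_mul]
    ring_nf

/-! ### Fourier transforms with monomial factors, and Gaussians -/

/-- The Fourier transform of `f` multiplied by the monomial `u_{v 0} ⋯ u_{v (k-1)}`. Up to the
factor `(-2πi)ᵏ` it is the partial derivative of the Fourier transform of `f` along `v`. -/
noncomputable def fourierMonomial {d k : ℕ} (v : Fin k → Fin d)
    (f : EuclideanSpace ℝ (Fin d) → ℝ) : EuclideanSpace ℝ (Fin d) → ℂ :=
  𝓕 fun u : EuclideanSpace ℝ (Fin d) => (((∏ j, u (v j)) * f u : ℝ) : ℂ)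

theorem fourierMonomial_elim0 {d : ℕ} (f : EuclideanSpace ℝ (Fin d) → ℝ) :
    fourierMonomial (Fin.elim0 : Fin 0 → Fin d) f = 𝓕 fun u => (f u : ℂ) := by
  simp [fourierMonomial]

theorem fourierMonomial_comp_smul {d k : ℕ} (v : Fin k → Fin d)
    (f : EuclideanSpace ℝ (Fin d) → ℝ) {τ : ℝ} (hτ : 0 < τ) (x : EuclideanSpace ℝ (Fin d)) :
    fourierMonomial v (fun u => f (τ • u)) x
      = ((τ ^ (d + k))⁻¹ : ℝ) • fourierMonomial v f (τ⁻¹ • x) := by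
  unfold fourierMonomial
  simp only [Real.fourier_eq]
  have h := Measure.integral_comp_smul_of_nonneg (volume : Measure (EuclideanSpace ℝ (Fin d)))
    (fun u => 𝐞 (-inner ℝ u (τ⁻¹ • x)) • (((∏ j, u (v j)) * f u : ℝ) : ℂ)) τ (hR := hτ.le)
  rw [finrank_euclideanSpace_fin] at h
  rw [pow_add, mul_inv, mul_comm, mul_smul, ← h, ← integral_smul]
  refine integral_congr_ae (ae_of_all _ fun u => ?_)
  have h1 : inner ℝ (τ • u) (τ⁻¹ • x) = inner ℝ u x := by
    rw [real_inner_smul_left, real_inner_smul_right]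
    field_simp
  have h2 : (∏ j, (τ • u) (v j)) = τ ^ k * ∏ j, u (v j) := by
    simp [Finset.prod_mul_distrib]
  simp only [h1, h2]
  rw [smul_comm]
  congr 1
  rw [Complex.real_smul, ← Complex.ofReal_mul]
  congr 1
  field_simp

theorem iteratedFDeriv_fourier_apply_single {d k : ℕ} (v : Fin k → Fin d)
    {f : EuclideanSpace ℝ (Fin d) → ℝ} (hf : AEStronglyMeasurable f)
    (hint : ∀ n : ℕ, Integrable fun u => ‖u‖ ^ n * |f u|) (x : EuclideanSpace ℝ (Fin d)) :
    iteratedFDeriv ℝ k (𝓕 fun u => (f u : ℂ)) x (fun j => EuclideanSpace.single (v j) (1 : ℝ))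
      = (-(2 * Real.pi * Complex.I)) ^ k * fourierMonomial v f x := by
  have hint' : ∀ n : ℕ, Integrable fun u => ‖u‖ ^ n * ‖(f u : ℂ)‖ := by
    simpa only [Complex.norm_real, Real.norm_eq_abs] using hint
  have hm : AEStronglyMeasurable fun u => (f u : ℂ) :=
    Complex.continuous_ofReal.comp_aestronglyMeasurable hf
  rw [Real.iteratedFDeriv_fourier (N := ⊤) (fun n _ => hint' n) hm le_top,
    Real.fourier_continuousMultilinearMap_apply
      (VectorFourier.integrable_fourierPowSMulRight _ (hint' k) hm)]
  have e : ∀ u : EuclideanSpace ℝ (Fin d),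
      VectorFourier.fourierPowSMulRight (innerSL ℝ) (fun u => (f u : ℂ)) u k
        (fun j => EuclideanSpace.single (v j) (1 : ℝ))
      = (-(2 * Real.pi * Complex.I)) ^ k • (((∏ j, u (v j)) * f u : ℝ) : ℂ) := by
    intro u
    rw [VectorFourier.fourierPowSMulRight_apply]
    have h : ∀ j, innerSL ℝ u (EuclideanSpace.single (v j) (1 : ℝ)) = u (v j) := fun j => by
      change inner ℝ u (EuclideanSpace.single (v j) (1 : ℝ)) = u (v j)
      simp [EuclideanSpace.inner_single_right]
    simp only [h, Complex.real_smul, Complex.ofReal_mul]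
  simp only [fourierMonomial, Real.fourier_eq, e]
  rw [← integral_const_mul]
  refine integral_congr_ae (ae_of_all _ fun u => ?_)
  exact smul_comm _ _ _

/-- The Gaussian `exp (-π |u|²)`, which is its own Fourier transform. -/
noncomputable def gauss {d : ℕ} (u : EuclideanSpace ℝ (Fin d)) : ℝ :=
  Real.exp (-(Real.pi * ‖u‖ ^ 2))

theorem fourier_gauss (d : ℕ) :
    (𝓕 fun u : EuclideanSpace ℝ (Fin d) => (gauss u : ℂ)) = fun u => (gauss u : ℂ) := by
  funext x
  have h := fourier_gaussian_innerProductSpace (b := (Real.pi : ℂ))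
    (by simpa using Real.pi_pos) x
  have hpi : (Real.pi : ℂ) ≠ 0 := Complex.ofReal_ne_zero.2 Real.pi_ne_zero
  have e : (fun u : EuclideanSpace ℝ (Fin d) => (gauss u : ℂ))
      = fun u => Complex.exp (-(Real.pi : ℂ) * (‖u‖ : ℂ) ^ 2) := by
    funext u
    simp [gauss]
  rw [e, h, div_self hpi, Complex.one_cpow, one_mul]
  rw [gauss, Complex.ofReal_exp]
  congr 1
  push_cast
  field_simp

theorem norm_iteratedFDeriv_exp (n : ℕ) (x : ℝ) : ‖iteratedFDeriv ℝ n Real.exp x‖ = Real.exp x := by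
  rw [norm_iteratedFDeriv_eq_norm_iteratedDeriv, iteratedDeriv_eq_iterate, Real.iter_deriv_exp,
    Real.norm_of_nonneg (Real.exp_pos _).le]

/-- The derivatives of the Gaussian decrease rapidly. -/
theorem exists_norm_iteratedFDeriv_gauss_le (d k N : ℕ) :
    ∃ C : ℝ, ∀ x : EuclideanSpace ℝ (Fin d),
      (1 + ‖x‖) ^ N * ‖iteratedFDeriv ℝ k (fun u => (gauss u : ℂ)) x‖ ≤ C := by
  -- the `k`-th derivative of `exp ∘ f` at `x` is `exp (f x)` up to a polynomial factor, by the
  -- bound for derivatives of a composition; the exponential absorbs that factor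
  have ht : (fun x : EuclideanSpace ℝ (Fin d) => -(Real.pi * ‖x‖ ^ 2)).HasTemperateGrowth :=
    ((Function.HasTemperateGrowth.const Real.pi).mul
      (Function.hasTemperateGrowth_norm_sq _)).neg
  obtain ⟨p, C, hC0, hC⟩ := ht.norm_iteratedFDeriv_le_uniform k
  set M := N + p * k with hM
  refine ⟨k.factorial * (1 + C) ^ k * (M.factorial * Real.exp 2), fun x => ?_⟩
  have hx : 1 ≤ 1 + ‖x‖ := by linarith [norm_nonneg x]
  have h1 : ‖iteratedFDeriv ℝ k (fun u => (gauss u : ℂ)) x‖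
      = ‖iteratedFDeriv ℝ k (fun u : EuclideanSpace ℝ (Fin d) => gauss u) x‖ :=
    Complex.ofRealLI.norm_iteratedFDeriv_comp_left (f := gauss)
      ((Real.contDiff_exp.comp ht.1).contDiffAt (n := ∞)) (by exact_mod_cast le_top)
  have h2 : ‖iteratedFDeriv ℝ k (fun u : EuclideanSpace ℝ (Fin d) => gauss u) x‖
      ≤ k.factorial * gauss x * ((1 + C) * (1 + ‖x‖) ^ p) ^ k := by
    refine norm_iteratedFDeriv_comp_le (N := ∞) (g := Real.exp) Real.contDiff_exp ht.1
      (by exact_mod_cast le_top) x (fun i _ => (norm_iteratedFDeriv_exp i _).le) fun i hi hik => ?_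
    have h3 : 1 ≤ (1 + ‖x‖) ^ p := one_le_pow₀ hx
    have h4 : C * (1 + ‖x‖) ^ p ≤ (1 + C) * (1 + ‖x‖) ^ p := by gcongr; linarith
    refine (hC i hik x).trans (h4.trans (le_self_pow₀ ?_ (by omega)))
    nlinarith
  have h5 : (1 + ‖x‖) ^ M ≤ M.factorial * Real.exp (1 + ‖x‖) := by
    have := Real.pow_div_factorial_le_exp (1 + ‖x‖) (by positivity) M
    rwa [div_le_iff₀ (by positivity), mul_comm] at this
  have h6 : Real.exp (1 + ‖x‖) * gauss x ≤ Real.exp 2 := by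
    rw [gauss, ← Real.exp_add]
    apply Real.exp_le_exp.2
    nlinarith [Real.pi_gt_three, sq_nonneg (‖x‖ - 1), sq_nonneg ‖x‖]
  rw [h1]
  calc (1 + ‖x‖) ^ N * ‖iteratedFDeriv ℝ k (fun u : EuclideanSpace ℝ (Fin d) => gauss u) x‖
      ≤ (1 + ‖x‖) ^ N * (k.factorial * gauss x * ((1 + C) * (1 + ‖x‖) ^ p) ^ k) := by gcongr
    _ = k.factorial * (1 + C) ^ k * ((1 + ‖x‖) ^ M * gauss x) := by
        rw [hM, mul_pow, ← pow_mul, pow_add]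
        ring
    _ ≤ k.factorial * (1 + C) ^ k * (M.factorial * Real.exp (1 + ‖x‖) * gauss x) := by
        gcongr
        exact (Real.exp_pos _).le
    _ ≤ _ := by
        rw [mul_assoc (M.factorial : ℝ)]
        gcongr

/-! ### Derivatives of Gaussians and of their mixtures -/

theorem norm_fourierMonomial_gauss_le (d : ℕ) {k : ℕ} (v : Fin k → Fin d)
    (hint : ∀ n : ℕ, Integrable fun u : EuclideanSpace ℝ (Fin d) => ‖u‖ ^ n * |gauss u|) :
    ∃ C : ℝ, 0 ≤ C ∧ ∀ y : EuclideanSpace ℝ (Fin d),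
      (1 + ‖y‖) ^ (d + k + 2) * ‖fourierMonomial v gauss y‖ ≤ C := by
  obtain ⟨C, hC⟩ := exists_norm_iteratedFDeriv_gauss_le d k (d + k + 2)
  have key : ∀ y : EuclideanSpace ℝ (Fin d),
      (1 + ‖y‖) ^ (d + k + 2) * ‖fourierMonomial v gauss y‖ ≤ C := by
    intro y
    refine le_trans ?_ (hC y)
    have hm : AEStronglyMeasurable (gauss (d := d)) := by
      unfold gauss
      exact Continuous.aestronglyMeasurable (by fun_prop)
    have h := iteratedFDeriv_fourier_apply_single v hm hint y
    rw [fourier_gauss] at h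
    have h2 := (iteratedFDeriv ℝ k (fun u : EuclideanSpace ℝ (Fin d) => (gauss u : ℂ)) y).le_opNorm
      (fun j => EuclideanSpace.single (v j) (1 : ℝ))
    rw [h, norm_mul, norm_pow] at h2
    simp only [PiLp.norm_single, norm_one, Finset.prod_const_one, mul_one] at h2
    have h3 : 1 ≤ ‖-(2 * Real.pi * Complex.I)‖ := by
      simp only [norm_neg, norm_mul, Complex.norm_I, Complex.norm_real, Complex.norm_ofNat, mul_one]
      rw [Real.norm_of_nonneg Real.pi_pos.le]
      linarith [Real.pi_gt_three]
    have h4 := le_mul_of_one_le_left (norm_nonneg (fourierMonomial v gauss y)) (one_le_pow₀ h3 (n := k))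
    exact mul_le_mul_of_nonneg_left (h4.trans h2) (by positivity)
  exact ⟨C, le_trans (by positivity) (key 0), key⟩

theorem integrable_norm_pow_mul_exp_neg_rpow {d : ℕ} (hd : 1 ≤ d) (n : ℕ) {p c : ℝ} (hp : 0 < p)
    (hc : 0 < c) :
    Integrable fun u : EuclideanSpace ℝ (Fin d) => ‖u‖ ^ n * Real.exp (-(c * ‖u‖ ^ p)) := by
  have : Nonempty (Fin d) := ⟨⟨0, hd⟩⟩
  refine (integrable_fun_norm_addHaar (volume : Measure (EuclideanSpace ℝ (Fin d)))
    (f := fun r : ℝ => r ^ n * Real.exp (-(c * r ^ p)))).2 ?_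
  have h := integrableOn_rpow_mul_exp_neg_mul_rpow (p := p)
    (s := ((Module.finrank ℝ (EuclideanSpace ℝ (Fin d)) - 1 + n : ℕ) : ℝ)) (b := c)
    (neg_one_lt_zero.trans_le (Nat.cast_nonneg _)) hp hc
  refine h.congr_fun (fun r _ => ?_) measurableSet_Ioi
  simp only [Real.rpow_natCast, smul_eq_mul, neg_mul]
  rw [pow_add, mul_assoc]

theorem integrable_norm_pow_mul_gauss {d : ℕ} (hd : 1 ≤ d) (n : ℕ) :
    Integrable fun u : EuclideanSpace ℝ (Fin d) => ‖u‖ ^ n * |gauss u| := by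
  refine (integrable_norm_pow_mul_exp_neg_rpow hd n two_pos Real.pi_pos).congr
    (ae_of_all _ fun u => ?_)
  simp only [gauss, abs_of_pos (Real.exp_pos _), Real.rpow_two]

/-- Rapid decay makes the Gaussian of any width `σ` obey the bound of a mixture: the factor
`1 - exp (-σ² / |x|²)` is comparable to `min 1 (σ² / |x|²)` and sums to a Laplace transform. -/
theorem exists_norm_fourierMonomial_gauss_smul_le {d : ℕ} (hd : 1 ≤ d) {k : ℕ}
    (v : Fin k → Fin d) :
    ∃ C : ℝ, 0 ≤ C ∧ ∀ σ : ℝ, 0 < σ → ∀ x : EuclideanSpace ℝ (Fin d), x ≠ 0 →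
      ‖fourierMonomial v (fun u => gauss (σ • u)) x‖
        ≤ C * (‖x‖ ^ (d + k))⁻¹ * (1 - Real.exp (-(σ ^ 2 * (‖x‖ ^ 2)⁻¹))) := by
  obtain ⟨C, hC0, hC⟩ := norm_fourierMonomial_gauss_le d v (integrable_norm_pow_mul_gauss hd)
  refine ⟨C, hC0, fun σ hσ x hx => ?_⟩
  have hr : 0 < ‖x‖ := norm_pos_iff.2 hx
  rw [fourierMonomial_comp_smul v _ hσ, norm_smul, Real.norm_of_nonneg (by positivity)]
  have hy : ‖σ⁻¹ • x‖ = ‖x‖ / σ := by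
    rw [norm_smul, Real.norm_of_nonneg (by positivity), div_eq_inv_mul]
  have h1 := hC (σ⁻¹ • x)
  rw [hy] at h1
  set r := ‖x‖ / σ with hrdef
  have hr0 : 0 < r := by positivity
  have h2 : r ^ (d + k) * (1 + r ^ 2) ≤ (1 + r) ^ (d + k + 2) := by
    rw [pow_add (1 + r)]
    gcongr
    · linarith
    · nlinarith
  have h3 : ‖fourierMonomial v gauss (σ⁻¹ • x)‖ ≤ C * (r ^ (d + k))⁻¹ * (1 + r ^ 2)⁻¹ := by
    rw [mul_assoc, ← mul_inv, ← div_eq_mul_inv, le_div_iff₀ (by positivity), mul_comm]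
    exact (mul_le_mul_of_nonneg_right h2 (norm_nonneg _)).trans h1
  have h4 : σ ^ 2 * (‖x‖ ^ 2)⁻¹ = (r ^ 2)⁻¹ := by
    rw [hrdef]
    field_simp
  have h5 : (1 + r ^ 2)⁻¹ ≤ 1 - Real.exp (-(r ^ 2)⁻¹) := by
    have h6 : Real.exp (-(r ^ 2)⁻¹) ≤ (1 + (r ^ 2)⁻¹)⁻¹ := by
      rw [Real.exp_neg]
      gcongr
      linarith [Real.add_one_le_exp (r ^ 2)⁻¹]
    have h7 : (1 + (r ^ 2)⁻¹)⁻¹ = 1 - (1 + r ^ 2)⁻¹ := by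
      field_simp
      ring
    linarith
  rw [h4]
  calc (σ ^ (d + k))⁻¹ * ‖fourierMonomial v gauss (σ⁻¹ • x)‖
      ≤ (σ ^ (d + k))⁻¹ * (C * (r ^ (d + k))⁻¹ * (1 + r ^ 2)⁻¹) := by gcongr
    _ = C * (‖x‖ ^ (d + k))⁻¹ * (1 + r ^ 2)⁻¹ := by
        rw [hrdef, div_pow]
        field_simp
    _ ≤ _ := by gcongr

theorem norm_fourierMonomial_integrand_le {d k : ℕ} (v : Fin k → Fin d) (θ : ℝ) (c : ℝ)
    (u : EuclideanSpace ℝ (Fin d)) :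
    ‖𝐞 θ • (((∏ j, u (v j)) * c : ℝ) : ℂ)‖ ≤ ‖u‖ ^ k * |c| := by
  rw [Circle.norm_smul, Complex.norm_real, norm_mul, Real.norm_eq_abs c, norm_prod]
  gcongr
  calc ∏ j, ‖u (v j)‖ ≤ ∏ _j : Fin k, ‖u‖ :=
        Finset.prod_le_prod (fun _ _ => norm_nonneg _) fun j _ => PiLp.norm_apply_le u (v j)
    _ = ‖u‖ ^ k := by simp

theorem aestronglyMeasurable_fourierMonomial_integrand {d k : ℕ} (v : Fin k → Fin d)
    (x : EuclideanSpace ℝ (Fin d)) {f : EuclideanSpace ℝ (Fin d) → ℝ} (hf : Measurable f) :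
    AEStronglyMeasurable fun u : EuclideanSpace ℝ (Fin d) =>
      𝐞 (-inner ℝ u x) • (((∏ j, u (v j)) * f u : ℝ) : ℂ) := by
  have h1 : Continuous fun u : EuclideanSpace ℝ (Fin d) => ((𝐞 (-inner ℝ u x) : Circle) : ℂ) :=
    continuous_subtype_val.comp (Real.continuous_fourierChar.comp (by fun_prop))
  have h2 : Measurable fun u : EuclideanSpace ℝ (Fin d) => (((∏ j, u (v j)) * f u : ℝ) : ℂ) := by
    have : Measurable fun u : EuclideanSpace ℝ (Fin d) => ∏ j, u (v j) :=
      Continuous.measurable (by fun_prop)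
    fun_prop
  exact (h1.measurable.mul h2).aestronglyMeasurable

/-- A mixture of Gaussian characteristic functions has the corresponding mixture of Gaussian
derivatives as Fourier transform. The weight `b 0` has to vanish, since the Gaussian with `m = 0` is
constant on the Fourier side. -/
theorem hasSum_fourierMonomial_gauss {d : ℕ} (hd : 1 ≤ d) {k : ℕ} (v : Fin k → Fin d) {b : ℕ → ℝ}
    (hb : ∀ m, 0 ≤ b m) (hb0 : b 0 = 0) (hsum : Summable b) {h : ℝ} (hh : 0 < h) {φ : ℝ → ℝ}
    (hφ : ∀ y : ℝ, 0 < y → HasSum (fun m : ℕ => b m * Real.exp (-((m : ℝ) * h * y))) (φ y))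
    (x : EuclideanSpace ℝ (Fin d)) :
    HasSum (fun m : ℕ => b m • fourierMonomial v (fun u => gauss (√(m * h) • u)) x)
      (fourierMonomial v (fun u => φ (Real.pi * ‖u‖ ^ 2)) x) := by
  have : Nonempty (Fin d) := ⟨⟨0, hd⟩⟩
  have hg : ∀ (m : ℕ) (u : EuclideanSpace ℝ (Fin d)),
      gauss (√(m * h) • u) = Real.exp (-((m : ℝ) * h * (Real.pi * ‖u‖ ^ 2))) := fun m u => by
    rw [gauss, norm_smul, mul_pow, Real.norm_of_nonneg (by positivity),
      Real.sq_sqrt (by positivity)]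
    ring_nf
  have key := hasSum_integral_of_dominated_convergence
    (μ := (volume : Measure (EuclideanSpace ℝ (Fin d))))
    (F := fun (m : ℕ) u => 𝐞 (-inner ℝ u x) •
      (((∏ j, u (v j)) * (b m * gauss (√(m * h) • u)) : ℝ) : ℂ))
    (f := fun u => 𝐞 (-inner ℝ u x) • (((∏ j, u (v j)) * φ (Real.pi * ‖u‖ ^ 2) : ℝ) : ℂ))
    (fun m u => b m * (‖u‖ ^ k * Real.exp (-(h * Real.pi * ‖u‖ ^ (2 : ℝ)))))
    (fun m => aestronglyMeasurable_fourierMonomial_integrand v x (by unfold gauss; fun_prop))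
    (fun m => ae_of_all _ fun u => ?_) (ae_of_all _ fun u => hsum.mul_right _) ?_ ?_
  · simp only [fourierMonomial, Real.fourier_eq]
    refine (funext fun m => ?_ : (fun m : ℕ => _) = fun m : ℕ => _) ▸ key
    rw [← integral_smul]
    refine integral_congr_ae (ae_of_all _ fun u => ?_)
    simp only
    symm
    rw [smul_comm, Complex.real_smul, ← Complex.ofReal_mul, mul_left_comm]
  · refine (norm_fourierMonomial_integrand_le v _ _ u).trans ?_
    rw [abs_mul, abs_of_nonneg (hb m), mul_left_comm]
    rcases Nat.eq_zero_or_pos m with rfl | hm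
    · simp [hb0]
    · have hm1 : (1 : ℝ) ≤ m := by exact_mod_cast hm
      refine mul_le_mul_of_nonneg_left (mul_le_mul_of_nonneg_left ?_ (by positivity)) (hb m)
      rw [hg, abs_of_pos (Real.exp_pos _), Real.rpow_two]
      apply Real.exp_le_exp.2
      have : 0 ≤ h * (Real.pi * ‖u‖ ^ 2) := by positivity
      nlinarith
  · simp_rw [tsum_mul_right]
    exact (integrable_norm_pow_mul_exp_neg_rpow hd k two_pos (by positivity)).const_mul _
  -- at `u = 0` the mixture is not assumed to converge to `φ`, but this is a null set as `d ≥ 1`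
  · have h0 : ∀ᵐ u : EuclideanSpace ℝ (Fin d), u ≠ 0 := by
      simp [ae_iff]
    filter_upwards [h0] with u hu
    have hu' : 0 < ‖u‖ := norm_pos_iff.2 hu
    have := hφ (Real.pi * ‖u‖ ^ 2) (by positivity)
    simp_rw [hg]
    have h2 := ((this.mul_left (∏ j, u (v j))).mapL Complex.ofRealCLM)
    exact h2.const_smul (𝐞 (-inner ℝ u x))

/-! ### The stable exponential -/

/-- The function `exp (-(π |u|²) ^ β)`, whose Fourier transform is the density of a multiple of a
`2β`-stable vector. -/
noncomputable def stableExp {d : ℕ} (β : ℝ) (u : EuclideanSpace ℝ (Fin d)) : ℝ :=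
  Real.exp (-(Real.pi * ‖u‖ ^ 2) ^ β)

theorem pi_mul_norm_sq_rpow {d : ℕ} (β : ℝ) (u : EuclideanSpace ℝ (Fin d)) :
    (Real.pi * ‖u‖ ^ 2) ^ β = Real.pi ^ β * ‖u‖ ^ (2 * β) := by
  rw [Real.mul_rpow Real.pi_pos.le (by positivity), Real.rpow_mul (norm_nonneg u), Real.rpow_two]

theorem continuous_stableExp (d : ℕ) {β : ℝ} (h0 : 0 < β) :
    Continuous (stableExp (d := d) β) := by
  unfold stableExp
  exact Real.continuous_exp.comp
    (Continuous.rpow_const (by fun_prop) fun _ => Or.inr h0.le).neg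

theorem integrable_norm_pow_mul_stableExp {d : ℕ} (hd : 1 ≤ d) (n : ℕ) {β : ℝ} (h0 : 0 < β) :
    Integrable fun u : EuclideanSpace ℝ (Fin d) => ‖u‖ ^ n * |stableExp β u| := by
  refine (integrable_norm_pow_mul_exp_neg_rpow hd n (p := 2 * β) (by positivity)
    (Real.rpow_pos_of_pos Real.pi_pos β)).congr (ae_of_all _ fun u => ?_)
  simp only [stableExp, abs_of_pos (Real.exp_pos _), pi_mul_norm_sq_rpow]

theorem tendsto_fourierMonomial_sibuyaLaplace {d : ℕ} (hd : 1 ≤ d) {k : ℕ} (v : Fin k → Fin d)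
    {β : ℝ} (h0 : 0 < β) (h1 : β < 1) (x : EuclideanSpace ℝ (Fin d)) :
    Tendsto (fun n => fourierMonomial v (fun u => sibuyaLaplace β n (Real.pi * ‖u‖ ^ 2)) x) atTop
      (𝓝 (fourierMonomial v (stableExp β) x)) := by
  simp only [fourierMonomial, Real.fourier_eq]
  refine tendsto_integral_filter_of_dominated_convergence
    (fun u => ‖u‖ ^ k * Real.exp (-(Real.pi ^ β / 2 * ‖u‖ ^ (2 * β))))
    (Eventually.of_forall fun n => aestronglyMeasurable_fourierMonomial_integrand v x
      (by unfold sibuyaLaplace; fun_prop)) ?_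
    (integrable_norm_pow_mul_exp_neg_rpow hd k (by positivity) (by positivity))
    (ae_of_all _ fun u => ?_)
  · filter_upwards [eventually_ne_atTop 0] with n hn
    refine ae_of_all _ fun u => (norm_fourierMonomial_integrand_le v _ _ u).trans ?_
    have hy : 0 ≤ Real.pi * ‖u‖ ^ 2 := by positivity
    rw [abs_of_nonneg (sibuyaLaplace_nonneg h0 n hy)]
    refine mul_le_mul_of_nonneg_left ((sibuyaLaplace_le h0 h1 hn hy).trans_eq ?_) (by positivity)
    rw [pi_mul_norm_sq_rpow]
    ring_nf
  · have := tendsto_sibuyaLaplace h0 (y := Real.pi * ‖u‖ ^ 2) (by positivity)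
    exact ((Complex.continuous_ofReal.tendsto _).comp (this.const_mul _)).const_smul _

/-- The bounds for the single Gaussians, averaged with the weights of the Sibuya sum, add up to the
Laplace transform itself. -/
theorem norm_fourierMonomial_sibuyaLaplace_le {d : ℕ} (hd : 1 ≤ d) {k : ℕ} (v : Fin k → Fin d)
    {β : ℝ} (h0 : 0 < β) (h1 : β < 1) :
    ∃ C : ℝ, 0 ≤ C ∧ ∀ n : ℕ, n ≠ 0 → ∀ x : EuclideanSpace ℝ (Fin d), x ≠ 0 →
      ‖fourierMonomial v (fun u => sibuyaLaplace β n (Real.pi * ‖u‖ ^ 2)) x‖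
        ≤ C * (‖x‖ ^ (d + k))⁻¹ * (1 - sibuyaLaplace β n (‖x‖ ^ 2)⁻¹) := by
  obtain ⟨C, hC0, hC⟩ := exists_norm_fourierMonomial_gauss_smul_le hd v
  refine ⟨C, hC0, fun n hn x hx => ?_⟩
  obtain ⟨b, hb, hb0, hsum, hle, hs⟩ := exists_hasSum_sibuyaLaplace h0 h1 hn
  set h : ℝ := (n : ℝ) ^ (-(1 / β))
  have hh : 0 < h := Real.rpow_pos_of_pos (by positivity) _
  have hr : 0 < ‖x‖ := norm_pos_iff.2 hx
  have hJ := hasSum_fourierMonomial_gauss hd v hb hb0 hsum hh hs x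
  have hR := (hsum.hasSum.sub (hs (‖x‖ ^ 2)⁻¹ (by positivity))).mul_left (C * (‖x‖ ^ (d + k))⁻¹)
  refine (hJ.norm_le_of_bounded hR fun m => ?_).trans (by gcongr)
  rw [norm_smul, Real.norm_of_nonneg (hb m)]
  rcases Nat.eq_zero_or_pos m with rfl | hm
  · simp [hb0]
  · have hm' : (0 : ℝ) < m := by exact_mod_cast hm
    have h2 := hC (√(m * h)) (by positivity) x hx
    rw [Real.sq_sqrt (by positivity)] at h2
    calc b m * _ ≤ b m * _ := mul_le_mul_of_nonneg_left h2 (hb m)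
      _ = _ := by ring

/-- The decay of the derivatives of the stable density: the limit of the bounds for the Sibuya
mixtures, in which `1 - exp (-|x| ^ (-2β))` is at most `|x| ^ (-2β)`. -/
theorem norm_fourierMonomial_stableExp_le_of_ne_zero {d : ℕ} (hd : 1 ≤ d) {k : ℕ}
    (v : Fin k → Fin d) {β : ℝ} (h0 : 0 < β) (h1 : β < 1) :
    ∃ C : ℝ, 0 ≤ C ∧ ∀ x : EuclideanSpace ℝ (Fin d), x ≠ 0 →
      ‖fourierMonomial v (stableExp β) x‖ ≤ C * ‖x‖ ^ (-((d : ℝ) + 2 * β + k)) := by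
  obtain ⟨C, hC0, hC⟩ := norm_fourierMonomial_sibuyaLaplace_le hd v h0 h1
  refine ⟨C, hC0, fun x hx => ?_⟩
  have hr : 0 < ‖x‖ := norm_pos_iff.2 hx
  have hlim := le_of_tendsto_of_tendsto (tendsto_fourierMonomial_sibuyaLaplace hd v h0 h1 x).norm
    (((tendsto_sibuyaLaplace h0 (y := (‖x‖ ^ 2)⁻¹) (by positivity)).const_sub 1).const_mul
      (C * (‖x‖ ^ (d + k))⁻¹))
    ((eventually_ne_atTop 0).mono fun n hn => hC n hn x hx)
  refine hlim.trans ?_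
  have h2 : 1 - Real.exp (-((‖x‖ ^ 2)⁻¹) ^ β) ≤ ((‖x‖ ^ 2)⁻¹) ^ β := by
    linarith [Real.add_one_le_exp (-((‖x‖ ^ 2)⁻¹) ^ β)]
  have h3 : (‖x‖ ^ (d + k))⁻¹ * ((‖x‖ ^ 2)⁻¹) ^ β = ‖x‖ ^ (-((d : ℝ) + 2 * β + k)) := by
    rw [← Real.rpow_natCast, ← Real.rpow_neg hr.le, ← Real.rpow_two, ← Real.rpow_neg hr.le,
      ← Real.rpow_mul hr.le, ← Real.rpow_add hr]
    push_cast
    ring_nf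
  rw [← h3, ← mul_assoc]
  gcongr

theorem exists_norm_fourierMonomial_stableExp_le {d : ℕ} (hd : 1 ≤ d) {k : ℕ}
    (v : Fin k → Fin d) {β : ℝ} (h0 : 0 < β) (h1 : β < 1) :
    ∃ C : ℝ, 0 ≤ C ∧ ∀ x : EuclideanSpace ℝ (Fin d),
      ‖fourierMonomial v (stableExp β) x‖ ≤ C * oneMinPowNeg ‖x‖ ((d : ℝ) + 2 * β + k) := by
  obtain ⟨C, hC0, hC⟩ := norm_fourierMonomial_stableExp_le_of_ne_zero hd v h0 h1
  obtain ⟨K, hK0, hK⟩ : ∃ K : ℝ, 0 ≤ K ∧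
      ∀ x : EuclideanSpace ℝ (Fin d), ‖fourierMonomial v (stableExp β) x‖ ≤ K := by
    refine ⟨∫ u : EuclideanSpace ℝ (Fin d), ‖u‖ ^ k * |stableExp β u|,
      integral_nonneg fun u => by positivity, fun x => ?_⟩
    simp only [fourierMonomial, Real.fourier_eq]
    exact norm_integral_le_of_norm_le (integrable_norm_pow_mul_stableExp hd k h0)
      (ae_of_all _ fun u => norm_fourierMonomial_integrand_le v _ _ u)
  refine ⟨C + K, by positivity, fun x => ?_⟩
  unfold oneMinPowNeg
  split_ifs with hx
  · linarith [hK x]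
  · rw [mul_min_of_nonneg _ _ (by positivity), mul_one]
    have hp : 0 ≤ ‖x‖ ^ (-((d : ℝ) + 2 * β + k)) := by positivity
    exact le_min (by linarith [hK x])
      ((hC x (norm_ne_zero_iff.1 hx)).trans (by gcongr; linarith))

/-- The Fourier transform of `stableExp β` is a limit of mixtures of Gaussians, hence nonnegative. -/
theorem fourier_stableExp_nonneg {d : ℕ} (hd : 1 ≤ d) {β : ℝ} (h0 : 0 < β) (h1 : β < 1)
    (x : EuclideanSpace ℝ (Fin d)) :
    0 ≤ (𝓕 (fun u : EuclideanSpace ℝ (Fin d) => (stableExp β u : ℂ)) x).re ∧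
      (𝓕 (fun u : EuclideanSpace ℝ (Fin d) => (stableExp β u : ℂ)) x).im = 0 := by
  let v : Fin 0 → Fin d := Fin.elim0
  have hv := fourierMonomial_elim0 (d := d)
  have hlim := tendsto_fourierMonomial_sibuyaLaplace hd v h0 h1 x
  rw [hv (stableExp β)] at hlim
  have hmem : ∀ n : ℕ, n ≠ 0 →
      fourierMonomial v (fun u => sibuyaLaplace β n (Real.pi * ‖u‖ ^ 2)) x
        ∈ {z : ℂ | 0 ≤ z.re ∧ z.im = 0} := by
    intro n hn
    obtain ⟨b, hb, hb0, hsum, -, hs⟩ := exists_hasSum_sibuyaLaplace h0 h1 hn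
    have hh : (0 : ℝ) < (n : ℝ) ^ (-(1 / β)) := Real.rpow_pos_of_pos (by positivity) _
    have hJ := hasSum_fourierMonomial_gauss hd v hb hb0 hsum hh hs x
    have hterm : ∀ m : ℕ, ∃ r : ℝ, 0 ≤ r ∧
        b m • fourierMonomial v (fun u => gauss (√(m * (n : ℝ) ^ (-(1 / β))) • u)) x = r := by
      intro m
      rcases Nat.eq_zero_or_pos m with rfl | hm
      · exact ⟨0, le_rfl, by simp [hb0]⟩
      -- a Gaussian is, up to a positive factor, the Fourier transform of a Gaussian
      · have hm' : (0 : ℝ) < m := by exact_mod_cast hm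
        have hσ : 0 < √(m * (n : ℝ) ^ (-(1 / β))) := by positivity
        rw [fourierMonomial_comp_smul v _ hσ, hv, fourier_gauss, Complex.real_smul,
          Complex.real_smul, ← Complex.ofReal_mul, ← Complex.ofReal_mul]
        refine ⟨_, ?_, rfl⟩
        have := hb m
        unfold gauss
        positivity
    choose r hr0 hr using hterm
    simp_rw [hr] at hJ
    have hre := hJ.mapL Complex.reCLM
    have him := hJ.mapL Complex.imCLM
    simp only [Complex.reCLM_apply, Complex.imCLM_apply, Complex.ofReal_re,
      Complex.ofReal_im] at hre him
    exact ⟨hre.nonneg hr0, him.unique hasSum_zero⟩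
  have hclosed : IsClosed {z : ℂ | 0 ≤ z.re ∧ z.im = 0} :=
    (isClosed_le continuous_const Complex.continuous_re).inter
      (isClosed_eq Complex.continuous_im continuous_const)
  exact hclosed.mem_of_tendsto hlim ((eventually_ne_atTop 0).mono hmem)

/-! ### The stable density -/

/-- The Fourier transform of `u ↦ exp (-(π |τ u|²) ^ β)`: the density of a `2β`-stable vector of
scale `τ`. The Fourier transform is real, so that taking the real part loses nothing. -/
noncomputable def stableDensity {d : ℕ} (β τ : ℝ) (x : EuclideanSpace ℝ (Fin d)) : ℝ :=
  (𝓕 (fun u : EuclideanSpace ℝ (Fin d) => (stableExp β (τ • u) : ℂ)) x).re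

section

variable {d : ℕ} {β τ : ℝ}

theorem integrable_norm_pow_mul_stableExp_smul (hd : 1 ≤ d) (h0 : 0 < β) (hτ : 0 < τ) (n : ℕ) :
    Integrable fun u : EuclideanSpace ℝ (Fin d) => ‖u‖ ^ n * |stableExp β (τ • u)| := by
  refine (((integrable_norm_pow_mul_stableExp hd n h0).comp_smul hτ.ne').const_mul
    (τ ^ n)⁻¹).congr (ae_of_all _ fun u => ?_)
  simp only [norm_smul, Real.norm_of_nonneg hτ.le, mul_pow]
  field_simp

theorem continuous_stableExp_smul (h0 : 0 < β) (τ : ℝ) :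
    Continuous fun u : EuclideanSpace ℝ (Fin d) => stableExp β (τ • u) :=
  (continuous_stableExp d h0).comp (continuous_const_smul τ)

theorem integrable_stableExp_smul (hd : 1 ≤ d) (h0 : 0 < β) (hτ : 0 < τ) :
    Integrable fun u : EuclideanSpace ℝ (Fin d) => (stableExp β (τ • u) : ℂ) := by
  have h := integrable_norm_pow_mul_stableExp_smul hd h0 hτ 0
  simp only [pow_zero, one_mul] at h
  refine Integrable.ofReal ((integrable_norm_iff ?_).1 h)
  exact (continuous_stableExp_smul h0 τ).aestronglyMeasurable

theorem fourier_stableExp_smul (hτ : 0 < τ) (x : EuclideanSpace ℝ (Fin d)) :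
    𝓕 (fun u : EuclideanSpace ℝ (Fin d) => (stableExp β (τ • u) : ℂ)) x
      = ((τ ^ d)⁻¹ : ℝ) •
        𝓕 (fun u : EuclideanSpace ℝ (Fin d) => (stableExp β u : ℂ)) (τ⁻¹ • x) := by
  have h := fourierMonomial_comp_smul (Fin.elim0 : Fin 0 → Fin d) (stableExp β) hτ x
  rwa [fourierMonomial_elim0, fourierMonomial_elim0] at h

theorem stableDensity_nonneg (hd : 1 ≤ d) (h0 : 0 < β) (h1 : β < 1) (hτ : 0 < τ)
    (x : EuclideanSpace ℝ (Fin d)) : 0 ≤ stableDensity β τ x := by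
  rw [stableDensity, fourier_stableExp_smul hτ, Complex.smul_re]
  exact smul_nonneg (by positivity) (fourier_stableExp_nonneg hd h0 h1 _).1

theorem fourier_stableExp_smul_eq_ofReal (hd : 1 ≤ d) (h0 : 0 < β) (h1 : β < 1) (hτ : 0 < τ)
    (x : EuclideanSpace ℝ (Fin d)) :
    𝓕 (fun u : EuclideanSpace ℝ (Fin d) => (stableExp β (τ • u) : ℂ)) x
      = (stableDensity β τ x : ℂ) := by
  apply Complex.ext
  · rfl
  · rw [fourier_stableExp_smul hτ, Complex.smul_im, (fourier_stableExp_nonneg hd h0 h1 _).2]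
    simp

theorem contDiff_fourier_stableExp_smul (hd : 1 ≤ d) (h0 : 0 < β) (hτ : 0 < τ) :
    ContDiff ℝ ∞ (𝓕 fun u : EuclideanSpace ℝ (Fin d) => (stableExp β (τ • u) : ℂ)) := by
  refine Real.contDiff_fourier (N := ⊤) fun n _ => ?_
  simpa only [Complex.norm_real, Real.norm_eq_abs] using
    integrable_norm_pow_mul_stableExp_smul hd h0 hτ n

theorem contDiff_stableDensity (hd : 1 ≤ d) (h0 : 0 < β) (hτ : 0 < τ) :
    ContDiff ℝ ∞ (stableDensity (d := d) β τ) :=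
  Complex.reCLM.contDiff.comp (contDiff_fourier_stableExp_smul hd h0 hτ)

theorem exists_abs_partialDeriv_stableDensity_le (hd : 1 ≤ d) {k : ℕ} (v : Fin k → Fin d)
    (h0 : 0 < β) (h1 : β < 1) :
    ∃ C : ℝ, 0 ≤ C ∧ ∀ τ : ℝ, 0 < τ → ∀ x : EuclideanSpace ℝ (Fin d),
      |partialDeriv v (stableDensity β τ) x|
        ≤ C * ((τ ^ (d + k))⁻¹ * oneMinPowNeg (‖x‖ / τ) ((d : ℝ) + 2 * β + k)) := by
  obtain ⟨C, hC0, hC⟩ := exists_norm_fourierMonomial_stableExp_le hd v h0 h1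
  refine ⟨‖-(2 * Real.pi * Complex.I)‖ ^ k * C, by positivity, fun τ hτ x => ?_⟩
  have e : partialDeriv v (stableDensity β τ) x
      = ((-(2 * Real.pi * Complex.I)) ^ k *
          fourierMonomial v (fun u => stableExp β (τ • u)) x).re := by
    rw [← iteratedFDeriv_fourier_apply_single v
      (continuous_stableExp_smul h0 τ).aestronglyMeasurable
      (integrable_norm_pow_mul_stableExp_smul hd h0 hτ) x, partialDeriv]
    have := Complex.reCLM.iteratedFDeriv_comp_left (x := x) (i := k)
      (contDiff_fourier_stableExp_smul (β := β) hd h0 hτ).contDiffAt (by exact_mod_cast le_top)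
    exact congrArg (fun M => M fun j => EuclideanSpace.single (v j) (1 : ℝ)) this
  have hy : ‖τ⁻¹ • x‖ = ‖x‖ / τ := by
    rw [norm_smul, Real.norm_of_nonneg (by positivity), div_eq_inv_mul]
  rw [e]
  refine (Complex.abs_re_le_norm _).trans ?_
  rw [norm_mul, norm_pow, fourierMonomial_comp_smul v _ hτ, norm_smul,
    Real.norm_of_nonneg (by positivity), mul_assoc (_ ^ k) C, mul_left_comm C]
  gcongr
  rw [← hy]
  exact hC _

/-- Comparison with the Japanese bracket, whose powers are known to be integrable. -/
theorem oneMinPowNeg_le {r s : ℝ} (hr : 0 ≤ r) (hs : 0 ≤ s) :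
    oneMinPowNeg r s ≤ 2 ^ s * (1 + r) ^ (-s) := by
  rw [Real.rpow_neg (by positivity), ← div_eq_mul_inv, ← Real.div_rpow (by norm_num) (by positivity)]
  have key : ∀ a : ℝ, 1 ≤ a → 1 ≤ a ^ s := fun a ha => Real.one_le_rpow ha hs
  unfold oneMinPowNeg
  split_ifs with h
  · exact key _ (by rw [h]; norm_num)
  have hr' : 0 < r := lt_of_le_of_ne hr (Ne.symm h)
  rcases le_total r 1 with h1 | h1
  · exact (min_le_left _ _).trans (key _ (by rw [le_div_iff₀ (by positivity)]; linarith))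
  · refine (min_le_right _ _).trans ?_
    rw [Real.rpow_neg hr, ← Real.inv_rpow hr]
    refine Real.rpow_le_rpow (by positivity) ?_ hs
    rw [inv_eq_one_div, div_le_div_iff₀ hr' (by positivity)]
    linarith

theorem integrable_fourier_stableExp_smul (hd : 1 ≤ d) (h0 : 0 < β) (h1 : β < 1) (hτ : 0 < τ) :
    Integrable (𝓕 fun u : EuclideanSpace ℝ (Fin d) => (stableExp β (τ • u) : ℂ)) := by
  have hone : Integrable (𝓕 fun u : EuclideanSpace ℝ (Fin d) => (stableExp β u : ℂ)) := by
    obtain ⟨C, hC0, hC⟩ :=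
      exists_norm_fourierMonomial_stableExp_le hd (Fin.elim0 : Fin 0 → Fin d) h0 h1
    simp only [fourierMonomial_elim0, Nat.cast_zero, add_zero] at hC
    have hint := (integrable_one_add_norm (E := EuclideanSpace ℝ (Fin d)) (μ := volume)
      (r := (d : ℝ) + 2 * β) (by rw [finrank_euclideanSpace_fin]; linarith)).const_mul
        (C * 2 ^ ((d : ℝ) + 2 * β))
    refine hint.mono' ?_ (ae_of_all _ fun x => ?_)
    · have := (contDiff_fourier_stableExp_smul (d := d) hd h0 one_pos).continuous
      simp only [one_smul] at this
      exact this.aestronglyMeasurable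
    · refine (hC x).trans ?_
      rw [mul_assoc]
      exact mul_le_mul_of_nonneg_left (oneMinPowNeg_le (norm_nonneg x) (by positivity)) hC0
  rw [funext fun x => fourier_stableExp_smul (β := β) hτ x]
  exact (hone.comp_smul (inv_ne_zero hτ.ne')).smul ((τ ^ d)⁻¹ : ℝ)

theorem integrable_stableDensity (hd : 1 ≤ d) (h0 : 0 < β) (h1 : β < 1) (hτ : 0 < τ) :
    Integrable (stableDensity (d := d) β τ) :=
  (integrable_fourier_stableExp_smul hd h0 h1 hτ).re

theorem isFiniteMeasure_withDensity_stableDensity (hd : 1 ≤ d) (h0 : 0 < β) (h1 : β < 1)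
    (hτ : 0 < τ) : IsFiniteMeasure ((volume : Measure (EuclideanSpace ℝ (Fin d))).withDensity
      fun y => ENNReal.ofReal (stableDensity β τ y)) :=
  isFiniteMeasure_withDensity_ofReal (integrable_stableDensity hd h0 h1 hτ).2

/-- Fourier inversion, after the change of normalization between `charFun` and the Fourier transform. -/
theorem charFun_withDensity_stableDensity (hd : 1 ≤ d) (h0 : 0 < β) (h1 : β < 1) (hτ : 0 < τ)
    (w : EuclideanSpace ℝ (Fin d)) :
    charFun ((volume : Measure (EuclideanSpace ℝ (Fin d))).withDensity
      fun y => ENNReal.ofReal (stableDensity β τ y)) w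
      = (stableExp β (τ • ((2 * Real.pi)⁻¹ • w)) : ℂ) := by
  have hinv := congrFun (Continuous.fourierInv_fourier_eq
    (Complex.continuous_ofReal.comp (continuous_stableExp_smul (d := d) h0 τ))
    (integrable_stableExp_smul hd h0 hτ) (integrable_fourier_stableExp_smul hd h0 h1 hτ))
    ((2 * Real.pi)⁻¹ • w)
  simp only [Function.comp_apply] at hinv
  rw [← hinv, Real.fourierInv_eq', charFun_apply, integral_withDensity_eq_integral_toReal_smul
    (contDiff_stableDensity hd h0 hτ).continuous.measurable.ennreal_ofReal
    (ae_of_all _ fun _ => ENNReal.ofReal_lt_top)]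
  refine integral_congr_ae (ae_of_all _ fun y => ?_)
  have hF := fourier_stableExp_smul_eq_ofReal hd h0 h1 hτ y
  simp only [Function.comp_def]
  rw [hF, ENNReal.toReal_ofReal (stableDensity_nonneg hd h0 h1 hτ y), Complex.real_smul,
    smul_eq_mul, mul_comm, real_inner_smul_right]
  congr 4
  field_simp

end

/-! ### Symmetric stable processes -/

/-- The scale `τ` at which `stableDensity (α / 2) τ` has the characteristic function
`exp (-t |u| ^ α)`. -/
noncomputable def stableScale (α t : ℝ) : ℝ := 2 * √Real.pi * t ^ (1 / α)

theorem stableScale_pos {α t : ℝ} (ht : 0 < t) : 0 < stableScale α t := by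
  unfold stableScale
  have := Real.pi_pos
  positivity

theorem one_le_two_mul_sqrt_pi : 1 ≤ 2 * √Real.pi := by
  have : 1 ≤ √Real.pi := Real.one_le_sqrt.2 (by linarith [Real.pi_gt_three])
  linarith

theorem stableExp_stableScale_smul {d : ℕ} {α t : ℝ} (hα : 0 < α) (ht : 0 < t)
    (w : EuclideanSpace ℝ (Fin d)) :
    stableExp (α / 2) (stableScale α t • ((2 * Real.pi)⁻¹ • w)) = Real.exp (-(t * ‖w‖ ^ α)) := by
  have hpi := Real.pi_pos
  have h1 : Real.pi * ‖stableScale α t • ((2 * Real.pi)⁻¹ • w)‖ ^ 2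
      = (t ^ (1 / α) * ‖w‖) ^ (2 : ℝ) := by
    rw [norm_smul, norm_smul, Real.norm_of_nonneg (stableScale_pos ht).le,
      Real.norm_of_nonneg (by positivity), stableScale, Real.rpow_two]
    simp only [mul_pow, Real.sq_sqrt hpi.le]
    field_simp
  rw [stableExp, h1, ← Real.rpow_mul (by positivity), mul_div_cancel₀ α two_ne_zero,
    Real.mul_rpow (by positivity) (norm_nonneg w), ← Real.rpow_mul ht.le,
    one_div_mul_cancel hα.ne', Real.rpow_one]

theorem map_add_const_withDensity {E : Type*} [NormedAddCommGroup E] [MeasurableSpace E]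
    [BorelSpace E] {μ : Measure E} [μ.IsAddLeftInvariant] [SFinite μ] (x : E) (g : E → ENNReal) :
    (μ.withDensity g).map (fun y => x + y) = μ.withDensity fun y => g (y - x) := by
  ext s hs
  rw [Measure.map_apply (measurable_const_add x) hs,
    withDensity_apply _ (measurable_const_add x hs), withDensity_apply _ hs,
    ← lintegral_indicator (measurable_const_add x hs), ← lintegral_indicator hs,
    ← lintegral_add_left_eq_self (s.indicator fun y => g (y - x)) x]
  refine lintegral_congr fun y => ?_
  simp only [Set.indicator, add_sub_cancel_left]
  rfl

/-- The law of `X t` has the density `stableDensity`, because the characteristic functions agree. -/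
theorem map_eq_withDensity_stableDensity {d : ℕ} (hd : 1 ≤ d) {α : ℝ} (hα0 : 0 < α) (hα2 : α < 2)
    {Ω : Type*} [MeasurableSpace Ω] {P : Measure Ω} [IsProbabilityMeasure P]
    {X : ℝ≥0 → Ω → EuclideanSpace ℝ (Fin d)} (hX : IsSymmetricStable d α P X) {t : ℝ≥0}
    (ht : 0 < t) :
    P.map (X t) = volume.withDensity
      fun y => ENNReal.ofReal (stableDensity (α / 2) (stableScale α t) y) := by
  have ht' : (0 : ℝ) < t := ht
  have h0 : 0 < α / 2 := by linarith
  have h1 : α / 2 < 1 := by linarith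
  have := isFiniteMeasure_withDensity_stableDensity hd h0 h1 (stableScale_pos (α := α) ht')
  refine Measure.ext_of_charFun (funext fun w => ?_)
  rw [hX.charFun_eq, charFun_withDensity_stableDensity hd h0 h1 (stableScale_pos ht'),
    stableExp_stableScale_smul hα0 ht']

theorem isTransitionDensity_stableDensity {d : ℕ} (hd : 1 ≤ d) {α : ℝ} (hα0 : 0 < α) (hα2 : α < 2)
    {Ω : Type*} [MeasurableSpace Ω] {P : Measure Ω} [IsProbabilityMeasure P]
    {X : ℝ≥0 → Ω → EuclideanSpace ℝ (Fin d)} (hX : IsSymmetricStable d α P X) :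
    IsTransitionDensity P X fun t x y => stableDensity (α / 2) (stableScale α t) (y - x) where
  nonneg t ht x y :=
    stableDensity_nonneg hd (by linarith) (by linarith) (stableScale_pos (NNReal.coe_pos.2 ht)) _
  continuous t ht x :=
    (contDiff_stableDensity hd (by linarith)
      (stableScale_pos (NNReal.coe_pos.2 ht))).continuous.comp (continuous_id.sub continuous_const)
  law_eq t ht x := by
    rw [← map_add_const_withDensity x
        fun y => ENNReal.ofReal (stableDensity (α / 2) (stableScale α t) y),
      ← map_eq_withDensity_stableDensity hd hα0 hα2 hX ht,
      Measure.map_map (measurable_const_add x) (hX.measurable t)]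
    rfl

/-- Any transition density from the origin is `stableDensity`: two densities of the same law agree
almost everywhere, and being continuous they agree everywhere. -/
theorem IsTransitionDensity.eq_stableDensity {d : ℕ} (hd : 1 ≤ d) {α : ℝ} (hα0 : 0 < α)
    (hα2 : α < 2) {Ω : Type*} [MeasurableSpace Ω] {P : Measure Ω} [IsProbabilityMeasure P]
    {X : ℝ≥0 → Ω → EuclideanSpace ℝ (Fin d)} (hX : IsSymmetricStable d α P X)
    {p : ℝ≥0 → EuclideanSpace ℝ (Fin d) → EuclideanSpace ℝ (Fin d) → ℝ}
    (hp : IsTransitionDensity P X p) {t : ℝ≥0} (ht : 0 < t) :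
    p t 0 = stableDensity (α / 2) (stableScale α t) := by
  have h0 : 0 < α / 2 := by linarith
  have h1 : α / 2 < 1 := by linarith
  have hτ : 0 < stableScale α t := stableScale_pos (NNReal.coe_pos.2 ht)
  have hc := (contDiff_stableDensity (d := d) hd h0 hτ).continuous
  have hlaw := hp.law_eq t ht 0
  simp only [zero_add] at hlaw
  have hlaw2 := map_eq_withDensity_stableDensity hd hα0 hα2 hX ht
  have hae := (withDensity_eq_iff (hp.continuous t ht 0).measurable.ennreal_ofReal.aemeasurable
    hc.measurable.ennreal_ofReal.aemeasurable (by
      have h := measure_ne_top (P.map fun a => X t a) Set.univ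
      rw [hlaw, withDensity_apply _ MeasurableSet.univ, Measure.restrict_univ] at h
      exact h)).1 (hlaw.symm.trans hlaw2)
  refine (Continuous.ae_eq_iff_eq volume (hp.continuous t ht 0) hc).1 ?_
  filter_upwards [hae] with y hy
  exact (ENNReal.ofReal_eq_ofReal_iff (hp.nonneg t ht 0 y)
    (stableDensity_nonneg hd h0 h1 hτ y)).1 hy

theorem oneMinPowNeg_div_mul_le {κ a r s : ℝ} (hκ : 1 ≤ κ) (ha : 0 < a) (hr : 0 ≤ r)
    (hs : 0 ≤ s) : oneMinPowNeg (r / (κ * a)) s ≤ κ ^ s * oneMinMulInv a r ^ s := by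
  have hκs : 1 ≤ κ ^ s := Real.one_le_rpow hκ hs
  have hκ0 : 0 < κ := by linarith
  rcases hr.eq_or_lt with rfl | hr
  · simpa [oneMinPowNeg, oneMinMulInv] using hκs
  have h1 : r / (κ * a) ≠ 0 := by positivity
  rw [oneMinPowNeg, oneMinMulInv, if_neg h1, if_neg hr.ne']
  rcases min_choice 1 (a * r⁻¹) with h | h <;> rw [h]
  · exact (min_le_left _ _).trans (by simpa using hκs)
  · refine (min_le_right _ _).trans_eq ?_
    rw [Real.rpow_neg (by positivity), ← Real.inv_rpow (by positivity),
      ← Real.mul_rpow hκ0.le (by positivity)]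
    congr 1
    field_simp

theorem oneMinMulInv_one_rpow_le {r s : ℝ} (hr : 0 ≤ r) (hs : 0 ≤ s) :
    oneMinMulInv 1 r ^ s ≤ oneMinPowNeg r s := by
  unfold oneMinPowNeg oneMinMulInv
  split_ifs with h
  · simp
  · rw [one_mul, Real.rpow_neg hr, ← Real.inv_rpow hr]
    have h1 : 0 ≤ min 1 r⁻¹ := le_min zero_le_one (by positivity)
    exact le_min (Real.rpow_le_one h1 (min_le_left _ _) hs)
      (Real.rpow_le_rpow h1 (min_le_right _ _) hs)

theorem exists_abs_partialDeriv_stableDensity_stableScale_le {d : ℕ} (hd : 1 ≤ d) {α : ℝ}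
    (hα0 : 0 < α) (hα2 : α < 2) {k : ℕ} (v : Fin k → Fin d) :
    ∃ C : ℝ, 0 ≤ C ∧ ∀ t : ℝ, 0 < t → ∀ x : EuclideanSpace ℝ (Fin d),
      |partialDeriv v (stableDensity (α / 2) (stableScale α t)) x|
        ≤ C * t ^ (-(((d : ℝ) + (k : ℝ)) / α))
            * oneMinMulInv (t ^ (1 / α)) ‖x‖ ^ ((d : ℝ) + α + (k : ℝ)) := by
  obtain ⟨C, hC0, hC⟩ := exists_abs_partialDeriv_stableDensity_le (β := α / 2) hd v
    (by linarith) (by linarith)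
  set κ : ℝ := 2 * √Real.pi
  set s : ℝ := (d : ℝ) + α + k with hs
  have hs0 : 0 ≤ s := by positivity
  have hκ : 1 ≤ κ := one_le_two_mul_sqrt_pi
  refine ⟨C * κ ^ s, by positivity, fun t ht x => ?_⟩
  have hta : 0 < t ^ (1 / α) := by positivity
  have h1 := hC _ (stableScale_pos (α := α) ht) x
  rw [mul_div_cancel₀ α two_ne_zero, ← hs] at h1
  have h2 : (stableScale α t ^ (d + k))⁻¹ ≤ t ^ (-(((d : ℝ) + (k : ℝ)) / α)) := by
    have : t ^ (-(((d : ℝ) + (k : ℝ)) / α)) = ((t ^ (1 / α)) ^ (d + k))⁻¹ := by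
      rw [← Real.rpow_natCast, ← Real.rpow_mul ht.le, ← Real.rpow_neg ht.le]
      push_cast
      ring_nf
    rw [this]
    gcongr
    exact le_mul_of_one_le_left hta.le hκ
  have h3 : oneMinPowNeg (‖x‖ / stableScale α t) s
      ≤ κ ^ s * oneMinMulInv (t ^ (1 / α)) ‖x‖ ^ s :=
    oneMinPowNeg_div_mul_le hκ hta (norm_nonneg x) hs0
  have h4 : 0 ≤ oneMinPowNeg (‖x‖ / stableScale α t) s := by
    have := (stableScale_pos (α := α) ht).le
    unfold oneMinPowNeg
    split_ifs <;> positivity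
  calc _ ≤ _ := h1
    _ ≤ C * (t ^ (-(((d : ℝ) + (k : ℝ)) / α)) *
          (κ ^ s * oneMinMulInv (t ^ (1 / α)) ‖x‖ ^ s)) := by gcongr
    _ = _ := by ring

end SymStable

theorem mainTheorem4 (d : ℕ) (hd : 1 ≤ d) (α : ℝ) (hα0 : 0 < α) (hα2 : α < 2) :
    ∃ c : ℝ, 0 < c ∧
      ∀ (Ω : Type*) [MeasurableSpace Ω] (P : Measure Ω) [IsProbabilityMeasure P]
        (X : ℝ≥0 → Ω → EuclideanSpace ℝ (Fin d)),
        SymStable.IsSymmetricStable d α P X →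
        (∃ p : ℝ≥0 → EuclideanSpace ℝ (Fin d) → EuclideanSpace ℝ (Fin d) → ℝ,
          SymStable.IsTransitionDensity P X p) ∧
        ∀ p : ℝ≥0 → EuclideanSpace ℝ (Fin d) → EuclideanSpace ℝ (Fin d) → ℝ,
          SymStable.IsTransitionDensity P X p →
          (∀ t : ℝ≥0, 0 < t → ContDiff ℝ ((⊤ : ℕ∞) : WithTop ℕ∞) (p t 0)) ∧
          (∀ k : ℕ, k ≤ 2 → ∀ (v : Fin k → Fin d) (x : EuclideanSpace ℝ (Fin d)),
            |SymStable.partialDeriv v (p 1 0) x|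
              ≤ c * SymStable.oneMinPowNeg ‖x‖ ((d : ℝ) + α + (k : ℝ))) ∧
          (∀ k : ℕ, k ≤ 2 → ∀ (v : Fin k → Fin d) (t : ℝ≥0), 0 < t →
            ∀ x : EuclideanSpace ℝ (Fin d),
            |SymStable.partialDeriv v (p t 0) x|
              ≤ c * (t : ℝ) ^ (-(((d : ℝ) + (k : ℝ)) / α))
                  * SymStable.oneMinMulInv ((t : ℝ) ^ (1 / α)) ‖x‖ ^ ((d : ℝ) + α + (k : ℝ))) := by
  choose C hC0 hC using fun (k : ℕ) (v : Fin k → Fin d) =>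
    SymStable.exists_abs_partialDeriv_stableDensity_stableScale_le hd hα0 hα2 v
  -- there are finitely many partial derivatives of order at most two
  set c : ℝ := 1 + ∑ k ∈ Finset.range 3, ∑ v : Fin k → Fin d, C k v with hc
  have hsum : ∀ k, 0 ≤ ∑ v : Fin k → Fin d, C k v := fun k =>
    Finset.sum_nonneg fun v _ => hC0 k v
  have hCc : ∀ k : ℕ, k ≤ 2 → ∀ v : Fin k → Fin d, C k v ≤ c := by
    intro k hk v
    have h1 := Finset.single_le_sum (fun v _ => hC0 k v) (Finset.mem_univ v)
    have h2 := Finset.single_le_sum (f := fun k => ∑ v : Fin k → Fin d, C k v)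
      (fun k _ => hsum k) (Finset.mem_range.2 (Nat.lt_succ_of_le hk))
    linarith
  have hb : ∀ k : ℕ, k ≤ 2 → ∀ (v : Fin k → Fin d) (t : ℝ), 0 < t →
      ∀ x : EuclideanSpace ℝ (Fin d),
      |SymStable.partialDeriv v (SymStable.stableDensity (α / 2) (SymStable.stableScale α t)) x|
        ≤ c * t ^ (-(((d : ℝ) + (k : ℝ)) / α))
            * SymStable.oneMinMulInv (t ^ (1 / α)) ‖x‖ ^ ((d : ℝ) + α + (k : ℝ)) := by
    intro k hk v t ht x
    have h0 : 0 ≤ SymStable.oneMinMulInv (t ^ (1 / α)) ‖x‖ := by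
      unfold SymStable.oneMinMulInv
      split_ifs <;> positivity
    refine (hC k v t ht x).trans ?_
    gcongr
    exact hCc k hk v
  refine ⟨c, ?_, fun Ω _ P _ X hX => ⟨⟨_, SymStable.isTransitionDensity_stableDensity hd hα0 hα2 hX⟩,
    fun p hp => ⟨fun t ht => ?_, fun k hk v x => ?_, fun k hk v t ht x => ?_⟩⟩⟩
  · have := Finset.sum_nonneg fun k (_ : k ∈ Finset.range 3) => hsum k
    linarith
  · rw [hp.eq_stableDensity hd hα0 hα2 hX ht]
    exact SymStable.contDiff_stableDensity hd (by linarith)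
      (SymStable.stableScale_pos (NNReal.coe_pos.2 ht))
  · rw [hp.eq_stableDensity hd hα0 hα2 hX one_pos, NNReal.coe_one]
    refine (hb k hk v 1 one_pos x).trans ?_
    rw [Real.one_rpow, Real.one_rpow, mul_one]
    have hc0 : 0 ≤ c := (hC0 k v).trans (hCc k hk v)
    exact mul_le_mul_of_nonneg_left
      (SymStable.oneMinMulInv_one_rpow_le (norm_nonneg x) (by positivity)) hc0
  · rw [hp.eq_stableDensity hd hα0 hα2 hX ht]
    exact hb k hk v t (NNReal.coe_pos.2 ht) x
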